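/- Let $p \equiv 3 \pmod 4$ be a prime and let $d \in \mathbb{F}_p$ with $d \neq 0, 1$. Let $N_{d[p]}$ denote the number of affine points of the Edwards curve $E_d$ over $\mathbb{F}_p$, that is, the number of pairs $(x,y) \in \mathbb{F}_p \times \mathbb{F}_p$ with $$x^2 + y^2 = 1 + d x^2 y^2$$ (the neutral element $(0,1)$ included). Then there exists an integer $T$ such that $$T \equiv \sum_{j=0}^{\frac{p-1}{2}} \binom{\frac{p-1}{2}}{j}^2 d^j \pmod p, \qquad |T| \le 2\sqrt{p},$$ and $$N_{d[p]} = p - 1 - 2\left(\frac{d}{p}\right) + T,$$ where $\left(\frac{d}{p}\right)$ is the Legendre symbol. -/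

import Mathlib

/-- The affine Edwards curve `E_d : x ^ 2 + y ^ 2 = 1 + d x ^ 2 y ^ 2`, as the set of its points
with coordinates in the field `F`. It contains the neutral element `(0, 1)`. -/
def edwardsCurve {F : Type*} [Field F] (d : F) : Set (F × F) :=
  {P | P.1 ^ 2 + P.2 ^ 2 = 1 + d * P.1 ^ 2 * P.2 ^ 2}

/-- The order `N_{d[p]}` of the Edwards curve `E_d` over `F_p`: the number of its affine points,
the neutral element `(0, 1)` included. -/
noncomputable def edwardsOrder (p : ℕ) [Fact p.Prime] (d : ZMod p) : ℕ :=
  (edwardsCurve d).ncard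

/-!
Write `χ` for the quadratic character of `F_p`. Solving the Edwards equation for `x` at fixed `y`
counts its points as `p - (1 + χ(d)) + ∑ y, χ((1 - y²)(1 - d y²))`; the correction `1 + χ(d)` is the
number of `y` with `d y² = 1`. Putting `u = y²` and weighting by `1 + χ(u)` splits the sum into
`∑ u, χ((1 - u)(1 - d u)) = -χ(d)` and `T = ∑ u, χ(u (1 - u)(1 - d u))`. This is the required `T`:
the point count is `ncard_edwardsCurve`, and Euler's criterion with the binomial theorem gives the
residue of `T` (`sum_legendre_pow`), the sign being `+` since `(p - 1) / 2` is odd.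

The bound `T² ≤ 4 p` is Hasse's theorem for the Legendre curve `y² = x (x - 1) (x - d)`, as
`T = ∑ v, χ(v (v - 1)(v - d))` by the substitution `v = d u`. It is proved by Manin's elementary
method (`LegendreTwist.sq_sum_quadraticChar_le`), over any finite field `F` with `q` elements, `q`
odd. Let `c = X (X - 1) (X - l)`. The curve `c y² = x (x - 1) (x - l)` over `F(X)` has the points
`Q = (X, 1)` and `P₀ = (X ^ q, c ^ ((q - 1) / 2))`. Let `d(n)` be the degree of the numerator of the
reduced `x`-coordinate of `P₀ + n Q`.

* If `f / g`, `A / B`, `C / D` are the reduced `x`-coordinates of `P`, `P + Q`, `P - Q`, then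
  `(A C : A D + B C : B D)` is given by explicit quadratic forms in `f` and `g`
  (`exists_xRep_add_sub`). Both triples are primitive, so they agree up to a unit
  (`IsReducedX.associated`). Comparing degrees gives `d(n + 1) + d(n - 1) = 2 d(n) + 2`
  (`degree_of_associated`).
* `d(0) = q`, and `d(-1) = q + 1 + ∑ a, χ(c(a))`, because the order of vanishing at `a ∈ F` of the
  denominator of `x(P₀ - Q)` is `1 + χ(c(a))` (`rootMultiplicity_of_reduced`).

So `d(n) = n² - S n + q` with `S = ∑ a, χ(c(a))`. This is nonnegative at all integers `n`, and as
`q` is odd the discriminant `S² - 4 q` cannot be positive (`sq_le_of_forall_nonneg`).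
-/

/-! ### The `x`-coordinates of `P + Q` and `P - Q` -/

namespace WeierstrassCurve.Affine.Point

/-- For points on `y² = x³ + a₂ x² + a₄ x`, the symmetric functions of the `x`-coordinates of
`P + Q` and `P - Q` are, up to a common nonzero factor, polynomials in the homogeneous
`x`-coordinate of `P` and the `x`-coordinate of `Q`. The doubling and the point at infinity are
included. -/
theorem exists_xRep_add_sub {K : Type*} [Field K] [DecidableEq K] {W : WeierstrassCurve.Affine K}
    (h1 : W.a₁ = 0) (h3 : W.a₃ = 0) (h6 : W.a₆ = 0) (P : W.Point) {x y : K}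
    (hQ : W.Nonsingular x y) (hy : 2 * y ≠ 0) :
    ∃ κ : K, κ ≠ 0 ∧
      (P + some x y hQ).xRep 0 * (P - some x y hQ).xRep 0 =
        κ * (P.xRep 0 * x - W.a₄ * P.xRep 1) ^ 2 ∧
      (P + some x y hQ).xRep 0 * (P - some x y hQ).xRep 1 +
        (P + some x y hQ).xRep 1 * (P - some x y hQ).xRep 0 =
        κ * (2 * ((P.xRep 0 + x * P.xRep 1) * (P.xRep 0 * x + W.a₄ * P.xRep 1) +
          2 * W.a₂ * x * P.xRep 0 * P.xRep 1)) ∧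
      (P + some x y hQ).xRep 1 * (P - some x y hQ).xRep 1 =
        κ * (P.xRep 0 - x * P.xRep 1) ^ 2 := by
  have hQ' := ((W.nonsingular_iff x y).1 hQ).1
  rw [W.equation_iff, h1, h3, h6] at hQ'
  have hyn : y ≠ W.negY x y := by
    simp only [negY, h1, h3]
    intro h
    exact hy (by linear_combination h)
  have h2 : (2 : K) ≠ 0 := left_ne_zero_of_mul hy
  have hy0 : y ≠ 0 := right_ne_zero_of_mul hy
  simp only [zero_mul, add_zero] at hQ'
  -- the tangent case `P = Q`
  have key : ∃ κ : K, κ ≠ 0 ∧ (some x y hQ + some x y hQ).xRep 0 = κ * (x * x - W.a₄) ^ 2 ∧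
      (some x y hQ + some x y hQ).xRep 1 =
        κ * (2 * ((x + x) * (x * x + W.a₄) + 2 * W.a₂ * x * x)) := by
    refine ⟨1 / (2 * y) ^ 2, one_div_ne_zero (pow_ne_zero 2 hy), ?_, ?_⟩
    · rw [add_self_of_Y_ne hyn, xRep_some, Matrix.cons_val_zero, addX, slope_of_Y_ne rfl hyn]
      simp only [negY, h1, h3]
      have e : y - (-y - 0 * x - 0) = 2 * y := by ring
      rw [e]
      field_simp
      linear_combination (-4 * W.a₂ - 8 * x) * hQ'
    · rw [add_self_of_Y_ne hyn, xRep_some, Matrix.cons_val_one, Matrix.cons_val_fin_one]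
      field_simp
      linear_combination 2 * hQ'
  rcases P with _ | ⟨x', y', hP⟩
  · refine ⟨1, one_ne_zero, ?_⟩
    rw [← zero_def, zero_add, zero_sub, xRep_neg, xRep_some, xRep_zero]
    simp
    constructor <;> ring
  · by_cases hx : x' = x
    · obtain ⟨κ, hκ, k1, k2⟩ := key
      refine ⟨κ, hκ, ?_⟩
      have : some x' y' hP = some x y hQ ∨ some x' y' hP = -some x y hQ := X_eq_iff.1 hx
      rcases this with h | h
      · rw [h, sub_self, k1, k2]
        simp
      · have e : -some x y hQ - some x y hQ = -(some x y hQ + some x y hQ) := by abel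
        rw [h, neg_add_cancel, e, xRep_neg, xRep_neg, k1, k2]
        simp
    · have hP' := ((W.nonsingular_iff x' y').1 hP).1
      rw [W.equation_iff, h1, h3, h6] at hP'
      simp only [zero_mul, add_zero] at hP'
      have hxx : x' - x ≠ 0 := sub_ne_zero.2 hx
      refine ⟨1 / (x' - x) ^ 2, one_div_ne_zero (pow_ne_zero 2 hxx), ?_⟩
      rw [sub_eq_add_neg, neg_some, add_of_X_ne hx, add_of_X_ne hx, xRep_some, xRep_some, xRep_some]
      simp only [Matrix.cons_val_zero, Matrix.cons_val_one, Matrix.cons_val_fin_one, addX,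
        slope_of_X_ne hx, negY, h1, h3]
      refine ⟨?_, ?_, ?_⟩
      · field_simp
        linear_combination
          (y' ^ 2 - y ^ 2 + (x' ^ 3 + W.a₂ * x' ^ 2 + W.a₄ * x') -
            (x ^ 3 + W.a₂ * x ^ 2 + W.a₄ * x)) * (hP' - hQ') -
          2 * (W.a₂ + x' + x) * (x' - x) ^ 2 * (hP' + hQ')
      · field_simp
        linear_combination 2 * hP' + 2 * hQ'
      · field_simp

end WeierstrassCurve.Affine.Point

/-! ### Primitive triples and degrees of polynomials -/

open Polynomial

/-- Two triples in a UFD that are proportional over the fraction field, each without a common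
irreducible factor, agree up to units. -/
theorem associated_of_proportional_of_primitive {R K : Type*} [CommRing R] [IsDomain R]
    [UniqueFactorizationMonoid R] [Field K] [Algebra R K] [IsFractionRing R K]
    {ι : Type*} (a b : ι → R) (κ : K) (hκ : κ ≠ 0)
    (h : ∀ i, algebraMap R K (a i) = κ * algebraMap R K (b i))
    (ha : ∀ π, Irreducible π → ∃ i, ¬ π ∣ a i) (hb : ∀ π, Irreducible π → ∃ i, ¬ π ∣ b i) :
    ∀ i, Associated (a i) (b i) := by
  obtain ⟨r, s, hrs, rfl⟩ := IsFractionRing.exists_reduced_fraction (A := R) κ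
  have hs0 : algebraMap R K s ≠ 0 := IsFractionRing.to_map_ne_zero_of_mem_nonZeroDivisors s.2
  have hr0 : r ≠ 0 := by
    rintro rfl
    exact hκ (by simp)
  have e : ∀ i, s * a i = r * b i := by
    intro i
    apply IsFractionRing.injective R K
    rw [map_mul, map_mul, h i, IsFractionRing.mk'_eq_div]
    field_simp
  have hsu : IsUnit (s : R) := by
    by_contra hn
    obtain ⟨π, hπ, hd⟩ := WfDvdMonoid.exists_irreducible_factor hn (nonZeroDivisors.coe_ne_zero s)
    obtain ⟨i, hi⟩ := hb π hπ
    have : π ∣ r * b i := by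
      rw [← e i]
      exact hd.mul_right _
    rcases hπ.prime.dvd_or_dvd this with h' | h'
    · exact hπ.not_isUnit (hrs h' hd)
    · exact hi h'
  have hru : IsUnit r := by
    by_contra hn
    obtain ⟨π, hπ, hd⟩ := WfDvdMonoid.exists_irreducible_factor hn hr0
    obtain ⟨i, hi⟩ := ha π hπ
    have : π ∣ s * a i := by
      rw [e i]
      exact hd.mul_right _
    rcases hπ.prime.dvd_or_dvd this with h' | h'
    · exact hπ.not_isUnit (hrs hd h')
    · exact hi h'
  intro i
  exact (associated_isUnit_mul_left_iff hsu).1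
    ((e i).symm ▸ (associated_isUnit_mul_left_iff hru).2 (Associated.refl _))

namespace LegendreTwist

/-- Gauss's lemma for the product `(A T + B) (C T + D)` of two primitive linear forms. -/
theorem not_dvd_symmetric {R : Type*} [CommRing R] {A B C D π : R} (hπ : Prime π)
    (h1 : IsCoprime A B) (h2 : IsCoprime C D) :
    ¬ (π ∣ A * C ∧ π ∣ A * D + B * C ∧ π ∣ B * D) := by
  rintro ⟨hac, hs, hbd⟩
  have n1 : ¬ (π ∣ A ∧ π ∣ B) := fun h ↦ hπ.not_isUnit (h1.isUnit_of_dvd' h.1 h.2)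
  have n2 : ¬ (π ∣ C ∧ π ∣ D) := fun h ↦ hπ.not_isUnit (h2.isUnit_of_dvd' h.1 h.2)
  rcases hπ.dvd_or_dvd hac with ha | hc
  · have : π ∣ B * C := (dvd_add_right (ha.mul_right D)).1 hs
    have hb : ¬ π ∣ B := fun h ↦ n1 ⟨ha, h⟩
    exact n2 ⟨(hπ.dvd_or_dvd this).resolve_left hb, (hπ.dvd_or_dvd hbd).resolve_left hb⟩
  · have : π ∣ A * D := (dvd_add_left (hc.mul_left B)).1 hs
    have hd : ¬ π ∣ D := fun h ↦ n2 ⟨hc, h⟩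
    exact n1 ⟨(hπ.dvd_or_dvd this).resolve_right hd, (hπ.dvd_or_dvd hbd).resolve_right hd⟩

variable {F : Type*} [Field F]

/-- The forms giving the symmetric functions of `x(P + Q)` and `x(P - Q)`, where `Q = (X, 1)` and
`x(P) = f / g` is reduced, have no common prime factor: this is where `l ≠ 0, 1` enters. -/
theorem not_dvd_addSub {l : F} (hl0 : l ≠ 0) (hl1 : l ≠ 1) (h2 : (2 : F) ≠ 0) {f g π : F[X]}
    (hπ : Prime π) (hfg : IsCoprime f g) :
    ¬ (π ∣ (f * X - C l * g) ^ 2 ∧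
      π ∣ 2 * ((f + X * g) * (f * X + C l * g) - 2 * (1 + C l) * X * f * g) ∧
      π ∣ (f - X * g) ^ 2) := by
  rintro ⟨ha, hs, hb⟩
  replace ha := hπ.dvd_of_dvd_pow ha
  replace hb := hπ.dvd_of_dvd_pow hb
  have unit_of : ∀ a : F, a ≠ 0 → ¬ π ∣ C a := fun a h h' ↦
    hπ.not_isUnit (isUnit_of_dvd_unit h' (isUnit_C.2 h.isUnit))
  have hg : ¬ π ∣ g := by
    intro h
    have : π ∣ f := (dvd_sub_left (h.mul_left X)).1 hb
    exact hπ.not_isUnit (hfg.isUnit_of_dvd' this h)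
  have hx : π ∣ X ^ 2 - C l := by
    have : π ∣ g * (X ^ 2 - C l) := by
      have e : g * (X ^ 2 - C l) = (f * X - C l * g) - X * (f - X * g) := by ring
      rw [e]
      exact dvd_sub ha (hb.mul_left _)
    exact (hπ.dvd_or_dvd this).resolve_left hg
  -- modulo `f - X * g`, the middle form is `4 g² X (X - 1) (X - l)`
  have hy : π ∣ C 4 * (g ^ 2 * (X * ((X - 1) * (X - C l)))) := by
    have e : C 4 * (g ^ 2 * (X * ((X - 1) * (X - C l)))) =
        2 * ((f + X * g) * (f * X + C l * g) - 2 * (1 + C l) * X * f * g) -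
        (f - X * g) * (2 * (X * f + C l * g + 2 * X ^ 2 * g - 2 * (1 + C l) * X * g)) := by
      rw [show (C 4 : F[X]) = 4 from rfl]
      ring
    rw [e]
    exact dvd_sub hs (hb.mul_right _)
  have h4 : (4 : F) ≠ 0 := by
    rw [show (4 : F) = 2 * 2 by norm_num]
    exact mul_ne_zero h2 h2
  replace hy := (hπ.dvd_or_dvd hy).resolve_left (unit_of 4 h4)
  replace hy := (hπ.dvd_or_dvd hy).resolve_left (fun h ↦ hg (hπ.dvd_of_dvd_pow h))
  rcases hπ.dvd_or_dvd hy with h | h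
  · apply unit_of l hl0
    have e : C l = X * X - (X ^ 2 - C l) := by ring
    rw [e]
    exact dvd_sub (h.mul_right _) hx
  rcases hπ.dvd_or_dvd h with h | h
  · apply unit_of (1 - l) (sub_ne_zero.2 hl1.symm)
    have e : C (1 - l) = (X ^ 2 - C l) - (X - 1) * (X + 1) := by
      rw [C_sub, C_1]
      ring
    rw [e]
    exact dvd_sub hx (h.mul_right _)
  · apply unit_of (l * (l - 1)) (mul_ne_zero hl0 (sub_ne_zero.2 hl1))
    have e : C (l * (l - 1)) = (X ^ 2 - C l) - (X - C l) * (X + C l) := by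
      rw [C_mul, C_sub, C_1]
      ring
    rw [e]
    exact dvd_sub hx (h.mul_right _)

/-- If the product of two fractions `A / B` and `C / D` has larger degree at infinity than both `1`
and their sum, then both have a pole at infinity. -/
theorem degree_lt_of_symmetric {A B C D : F[X]} (h1 : (B * D).degree < (A * C).degree)
    (h2 : (A * D + B * C).degree < (A * C).degree) : B.degree < A.degree ∧ D.degree < C.degree := by
  have key : ∀ A B C D : F[X], (B * D).degree < (A * C).degree →
      (A * D + B * C).degree < (A * C).degree → D.degree < C.degree := by
    intro A B C D h1 h2
    by_contra! h
    have hA0 : A ≠ 0 := by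
      rintro rfl
      simp at h1
    have hAD : (A * C).degree ≤ (A * D).degree := by
      rw [degree_mul, degree_mul]
      gcongr
    have hlt : (B * C).degree < (A * D).degree := by
      by_contra! h3
      have hBA : A.degree ≤ B.degree := by
        have hC : C ≠ 0 := by
          rintro rfl
          simp at h1
        have hD : D ≠ 0 := by
          rintro rfl
          exact hC (degree_eq_bot.1 (le_bot_iff.1 (by simpa using h)))
        by_contra! h4
        have : (B * C).degree < (A * D).degree := by
          rw [degree_mul, degree_mul]
          by_cases hB : B = 0
          · subst hB
            rw [degree_zero, WithBot.bot_add, bot_lt_iff_ne_bot, ← degree_mul, Ne, degree_eq_bot]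
            exact mul_ne_zero hA0 hD
          · rw [degree_eq_natDegree hA0, degree_eq_natDegree hB, degree_eq_natDegree hC,
              degree_eq_natDegree hD] at *
            norm_cast at *
            omega
        exact absurd h3 (not_le.2 this)
      have : (A * C).degree ≤ (B * D).degree := by
        rw [degree_mul, degree_mul]
        gcongr
      exact absurd h1 (not_lt.2 this)
    rw [degree_add_eq_left_of_degree_lt hlt] at h2
    exact absurd h2 (not_lt.2 hAD)
  refine ⟨key C D A B ?_ ?_, key A B C D h1 h2⟩
  · rwa [mul_comm D, mul_comm C]
  · rwa [mul_comm C A, mul_comm C B, mul_comm D A, add_comm]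

/-- The parallelogram law for the degree of the numerator of the `x`-coordinate: if `f / g`, `A / B`
and `C' / D` represent `P`, `P + Q` and `P - Q`, with `Q = (X, 1)`, and `f / g` has a pole at
infinity, then so have the other two, and the degrees are related as stated. -/
theorem degree_of_associated {l : F} {f g A B C' D : F[X]} (hgf : g.degree < f.degree)
    (h1 : Associated (A * C') ((f * X - C l * g) ^ 2))
    (h2 : Associated (A * D + B * C')
      (2 * ((f + X * g) * (f * X + C l * g) - 2 * (1 + C l) * X * f * g)))
    (h3 : Associated (B * D) ((f - X * g) ^ 2)) :
    (B.degree < A.degree ∧ D.degree < C'.degree) ∧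
      A.natDegree + C'.natDegree = 2 * f.natDegree + 2 := by
  have hf0 : f ≠ 0 := by
    rintro rfl
    simp at hgf
  have hf := degree_eq_natDegree hf0
  set n := f.natDegree with hn
  have hfle : f.degree ≤ ((n : ℕ) : WithBot ℕ) := hf.le
  have hgle : (X * g).degree ≤ ((n : ℕ) : WithBot ℕ) := by
    rw [mul_comm, degree_mul_X]
    rw [hf] at hgf
    exact Nat.WithBot.add_one_le_of_lt hgf
  have hgle' : g.degree ≤ ((n : ℕ) : WithBot ℕ) := hf ▸ hgf.le
  have hcg : ∀ a : F, (C a * g).degree ≤ ((n : ℕ) : WithBot ℕ) := 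
    fun a ↦ (degree_mul_le_of_le degree_C_le hgle').trans_eq (zero_add _)
  have hfx : (f * X).degree = ((n + 1 : ℕ) : WithBot ℕ) := by
    rw [degree_mul_X, hf]
    norm_cast
  have hlt : ((n : ℕ) : WithBot ℕ) < ((n + 1 : ℕ) : WithBot ℕ) := by exact_mod_cast n.lt_succ_self
  have e1 : (A * C').degree = ((2 * n + 2 : ℕ) : WithBot ℕ) := by
    rw [degree_eq_degree_of_associated h1, degree_pow, degree_sub_eq_left_of_degree_lt, hfx]
    · norm_cast
    · rw [hfx]
      exact (hcg l).trans_lt hlt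
  have e2 : (A * D + B * C').degree ≤ ((2 * n + 1 : ℕ) : WithBot ℕ) := by
    rw [degree_eq_degree_of_associated h2]
    have t0 : ∀ u : F[X], u.degree ≤ ((2 * n + 1 : ℕ) : WithBot ℕ) →
        ∀ a : F, (C a * u).degree ≤ ((2 * n + 1 : ℕ) : WithBot ℕ) :=
      fun u h a ↦ (degree_mul_le_of_le degree_C_le h).trans_eq (zero_add _)
    have t1 : ((f + X * g) * (f * X + C l * g)).degree ≤ ((2 * n + 1 : ℕ) : WithBot ℕ) := by
      refine (degree_mul_le_of_le (degree_add_le_of_le hfle hgle)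
        (degree_add_le_of_le hfx.le ((hcg l).trans hlt.le))).trans ?_
      rw [max_self, max_self]
      norm_cast
      omega
    have t2 : (f * (X * g)).degree ≤ ((2 * n + 1 : ℕ) : WithBot ℕ) := by
      refine (degree_mul_le_of_le hfle hgle).trans ?_
      norm_cast
      omega
    have e : 2 * ((f + X * g) * (f * X + C l * g) - 2 * (1 + C l) * X * f * g) =
        C 2 * ((f + X * g) * (f * X + C l * g) - C (2 * (1 + l)) * (f * (X * g))) := by
      rw [C_mul, C_add, C_1, show (C 2 : F[X]) = 2 from rfl]
      ring
    rw [e]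
    exact t0 _ ((degree_sub_le_of_le t1 (t0 _ t2 _)).trans_eq (max_self _)) 2
  have e3 : (B * D).degree ≤ ((2 * n : ℕ) : WithBot ℕ) := by
    rw [degree_eq_degree_of_associated h3, sq]
    refine (degree_mul_le_of_le (degree_sub_le_of_le hfle hgle)
      (degree_sub_le_of_le hfle hgle)).trans ?_
    rw [max_self]
    norm_cast
    omega
  refine ⟨degree_lt_of_symmetric ?_ ?_, ?_⟩
  · rw [e1]
    refine e3.trans_lt ?_
    exact_mod_cast (by omega)
  · rw [e1]
    refine e2.trans_lt ?_
    exact_mod_cast (by omega)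
  · have hne : A * C' ≠ 0 := by
      intro h
      rw [h, degree_zero] at e1
      exact absurd e1.symm (WithBot.coe_ne_bot)
    rw [← natDegree_mul (left_ne_zero_of_mul hne) (right_ne_zero_of_mul hne)]
    exact natDegree_eq_of_degree_eq_some e1

/-! ### The twisted Legendre curve over the rational function field -/

variable {F : Type*} [Field F]

/-- The Legendre cubic `X (X - 1) (X - l)`. -/
noncomputable def cubic (l : F) : F[X] := X * (X - 1) * (X - C l)

/-- The quadratic twist of the Legendre curve `y² = x (x - 1) (x - l)` by the cubic `c = cubic l`
itself, over `F(X)`. The equation `c y² = x (x - 1) (x - l)` is made monic by the substitution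
`(x, y) ↦ (c x, c² y)`, so its `x`-coordinate is `1 / c` times the one of this model. -/
noncomputable def twist (l : F) : WeierstrassCurve.Affine (RatFunc F) where
  a₁ := 0
  a₂ := -algebraMap F[X] (RatFunc F) (cubic l * (1 + C l))
  a₃ := 0
  a₄ := algebraMap F[X] (RatFunc F) (C l * cubic l ^ 2)
  a₆ := 0

theorem twist_a₂ (l : F) :
    (twist l).a₂ = -algebraMap F[X] (RatFunc F) (cubic l * (1 + C l)) := rfl

theorem twist_a₄ (l : F) : (twist l).a₄ = algebraMap F[X] (RatFunc F) (C l * cubic l ^ 2) := rfl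

theorem cubic_ne_zero (l : F) : cubic l ≠ 0 :=
  mul_ne_zero (mul_ne_zero X_ne_zero (X_sub_C_ne_zero 1)) (X_sub_C_ne_zero l)

theorem algebraMap_ratFunc_ne_zero_iff {f : F[X]} : algebraMap F[X] (RatFunc F) f ≠ 0 ↔ f ≠ 0 :=
  map_ne_zero_iff _ (RatFunc.algebraMap_injective F)

/-- `f / g` is a reduced fraction representing the untwisted `x`-coordinate (that is, `x / c`) of
the point `P` of the twist, as a point of the projective line. -/
def IsReducedX {l : F} (P : (twist l).Point) (f g : F[X]) : Prop :=
  IsCoprime f g ∧ algebraMap F[X] (RatFunc F) (f * cubic l) * P.xRep 1 =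
    algebraMap F[X] (RatFunc F) g * P.xRep 0

theorem exists_isReducedX {l : F} (P : (twist l).Point) : ∃ f g : F[X], IsReducedX P f g := by
  rcases P with _ | ⟨x, y, h⟩
  · exact ⟨1, 0, isCoprime_one_left, by simp [← WeierstrassCurve.Affine.Point.zero_def]⟩
  · have hc : algebraMap F[X] (RatFunc F) (cubic l) ≠ 0 :=
      algebraMap_ratFunc_ne_zero_iff.2 (cubic_ne_zero l)
    set z : RatFunc F := x / algebraMap F[X] (RatFunc F) (cubic l) with hz
    refine ⟨z.num, z.denom, RatFunc.isCoprime_num_denom z, ?_⟩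
    have hd : algebraMap F[X] (RatFunc F) z.denom ≠ 0 :=
      algebraMap_ratFunc_ne_zero_iff.2 (RatFunc.denom_ne_zero z)
    have e := RatFunc.num_div_denom z
    rw [div_eq_iff hd] at e
    simp only [WeierstrassCurve.Affine.Point.xRep_some, Matrix.cons_val_zero, Matrix.cons_val_one,
      Matrix.cons_val_fin_one, map_mul, e, mul_one]
    rw [hz]
    field_simp

/-- `(c f : g)` is the `x`-coordinate of `P` as a point of the projective line. -/
theorem IsReducedX.exists_smul {l : F} {P : (twist l).Point} {f g : F[X]} (h : IsReducedX P f g) :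
    ∃ v : RatFunc F, v ≠ 0 ∧ algebraMap F[X] (RatFunc F) (f * cubic l) = v * P.xRep 0 ∧
      algebraMap F[X] (RatFunc F) g = v * P.xRep 1 := by
  obtain ⟨hfg, h⟩ := h
  rcases P with _ | ⟨x, y, hP⟩
  · rw [← WeierstrassCurve.Affine.Point.zero_def, WeierstrassCurve.Affine.Point.xRep_zero] at *
    simp only [Matrix.cons_val_zero, Matrix.cons_val_one, Matrix.cons_val_fin_one, mul_zero,
      mul_one] at *
    have hg : g = 0 := by
      by_contra hg
      exact algebraMap_ratFunc_ne_zero_iff.2 hg h.symm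
    refine ⟨_, algebraMap_ratFunc_ne_zero_iff.2 (mul_ne_zero ?_ (cubic_ne_zero l)), rfl,
      by rw [hg, map_zero]⟩
    rintro rfl
    exact hfg.ne_zero_or_ne_zero.elim (· rfl) (· hg)
  · simp only [WeierstrassCurve.Affine.Point.xRep_some, Matrix.cons_val_zero, Matrix.cons_val_one,
      Matrix.cons_val_fin_one, mul_one] at *
    refine ⟨_, algebraMap_ratFunc_ne_zero_iff.2 ?_, h, rfl⟩
    rintro rfl
    rw [map_zero, zero_mul] at h
    have hf : f = 0 := by
      by_contra hf
      exact algebraMap_ratFunc_ne_zero_iff.2 (mul_ne_zero hf (cubic_ne_zero l)) h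
    exact hfg.ne_zero_or_ne_zero.elim (· hf) (· rfl)

/-- A point `(x, y)` of `c y² = x (x - 1) (x - l)` gives the point `(c x, c² y)` of the twist. -/
theorem nonsingular_twist {l : F} (h2 : (2 : F) ≠ 0) {x y : F[X]} (hy : y ≠ 0)
    (h : cubic l * y ^ 2 = x * (x - 1) * (x - C l)) :
    (twist l).Nonsingular (algebraMap F[X] (RatFunc F) (cubic l * x))
      (algebraMap F[X] (RatFunc F) (cubic l ^ 2 * y)) := by
  rw [WeierstrassCurve.Affine.nonsingular_iff, WeierstrassCurve.Affine.equation_iff]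
  refine ⟨?_, Or.inr ?_⟩
  · simp only [twist, zero_mul, add_zero, ← map_mul, ← map_pow, ← map_add, ← map_neg]
    congr 1
    linear_combination cubic l ^ 3 * h
  · simp only [twist, zero_mul, sub_zero]
    rw [ne_eq, eq_neg_iff_add_eq_zero, ← map_add]
    refine algebraMap_ratFunc_ne_zero_iff.2 ?_
    rw [← two_mul, show (2 : F[X]) = C 2 from rfl]
    exact mul_ne_zero (C_ne_zero.2 h2) (mul_ne_zero (pow_ne_zero 2 (cubic_ne_zero l)) hy)

theorem nonsingular_generic (l : F) (h2 : (2 : F) ≠ 0) :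
    (twist l).Nonsingular (algebraMap F[X] (RatFunc F) (cubic l * X))
      (algebraMap F[X] (RatFunc F) (cubic l ^ 2 * 1)) :=
  nonsingular_twist h2 one_ne_zero (by rw [cubic, one_pow, mul_one])

/-- The tautological point `(X, 1)` of `c y² = x (x - 1) (x - l)`. -/
noncomputable def genericPoint (l : F) (h2 : (2 : F) ≠ 0) : (twist l).Point :=
  .some _ _ (nonsingular_generic l h2)

/-- Reduced fractions for `P ± Q`, with `Q` the generic point, are determined up to units by one
for `P`, through the symmetric functions. -/
theorem IsReducedX.associated [DecidableEq (RatFunc F)] {l : F} (hl0 : l ≠ 0) (hl1 : l ≠ 1)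
    (h2 : (2 : F) ≠ 0) {P : (twist l).Point} {f g A B C' D : F[X]} (h : IsReducedX P f g)
    (hA : IsReducedX (P + genericPoint l h2) A B) (hC : IsReducedX (P - genericPoint l h2) C' D) :
    Associated (A * C') ((f * X - C l * g) ^ 2) ∧
    Associated (A * D + B * C')
      (2 * ((f + X * g) * (f * X + C l * g) - 2 * (1 + C l) * X * f * g)) ∧
    Associated (B * D) ((f - X * g) ^ 2) := by
  have hc := algebraMap_ratFunc_ne_zero_iff.2 (cubic_ne_zero l)
  obtain ⟨u, hu, u0, u1⟩ := h.exists_smul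
  obtain ⟨v, hv, v0, v1⟩ := hA.exists_smul
  obtain ⟨w, hw, w0, w1⟩ := hC.exists_smul
  have h2' : (2 : RatFunc F) ≠ 0 := by
    have := algebraMap_ratFunc_ne_zero_iff.2 (C_ne_zero.2 h2)
    rwa [show (C 2 : F[X]) = 2 from rfl, map_ofNat] at this
  have hy : 2 * algebraMap F[X] (RatFunc F) (cubic l ^ 2 * 1) ≠ 0 :=
    mul_ne_zero h2' (algebraMap_ratFunc_ne_zero_iff.2
      (mul_ne_zero (pow_ne_zero 2 (cubic_ne_zero l)) one_ne_zero))
  obtain ⟨κ, hκ, k0, k1, k2⟩ := WeierstrassCurve.Affine.Point.exists_xRep_add_sub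
    (W := twist l) rfl rfl rfl P (nonsingular_generic l h2) hy
  have hQ : .some _ _ (nonsingular_generic l h2) = genericPoint l h2 := rfl
  rw [hQ] at k0 k1 k2
  rw [twist_a₄] at k0
  rw [twist_a₂, twist_a₄] at k1
  set c := algebraMap F[X] (RatFunc F) (cubic l) with hcdef
  set S := (P + genericPoint l h2).xRep
  set E := (P - genericPoint l h2).xRep
  set p := P.xRep
  simp only [map_mul, map_pow, map_add, map_one, ← hcdef] at k0 k1 k2 u0 v0 w0
  have p0 : p 0 = algebraMap F[X] (RatFunc F) f * c / u := by
    rw [u0]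
    field_simp
  have p1 : p 1 = algebraMap F[X] (RatFunc F) g / u := by
    rw [u1]
    field_simp
  have key := associated_of_proportional_of_primitive (K := RatFunc F)
    ![A * C', A * D + B * C', B * D]
    ![(f * X - C l * g) ^ 2,
      2 * ((f + X * g) * (f * X + C l * g) - 2 * (1 + C l) * X * f * g), (f - X * g) ^ 2]
    (v * w * κ * c ^ 2 / u ^ 2)
    (div_ne_zero (mul_ne_zero (mul_ne_zero (mul_ne_zero hv hw) hκ) (pow_ne_zero 2 hc))
      (pow_ne_zero 2 hu)) ?_ ?_ ?_
  · exact ⟨key 0, key 1, key 2⟩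
  · intro i
    fin_cases i
    · simp only [Fin.zero_eta, Matrix.cons_val_zero, map_mul, map_pow, map_sub]
      apply mul_right_cancel₀ (pow_ne_zero 2 hc)
      rw [p0, p1] at k0
      calc _ = (algebraMap F[X] (RatFunc F) A * c) * (algebraMap F[X] (RatFunc F) C' * c) := by ring
        _ = v * w * (S 0 * E 0) := by rw [v0, w0]; ring
        _ = _ := by
          rw [k0]
          field_simp
    · simp only [Fin.mk_one, Matrix.cons_val_one, Matrix.cons_val_zero, map_mul, map_add, map_sub,
        map_ofNat, map_one]
      apply mul_right_cancel₀ hc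
      rw [p0, p1] at k1
      calc _ = (algebraMap F[X] (RatFunc F) A * c) * algebraMap F[X] (RatFunc F) D +
            algebraMap F[X] (RatFunc F) B * (algebraMap F[X] (RatFunc F) C' * c) := by ring
        _ = v * w * (S 0 * E 1 + S 1 * E 0) := by rw [v0, w0, v1, w1]; ring
        _ = _ := by
          rw [k1]
          field_simp
          ring
    · simp only [Fin.reduceFinMk, Matrix.cons_val, map_mul, map_pow, map_sub]
      rw [p0, p1] at k2
      calc _ = v * w * (S 1 * E 1) := by rw [v1, w1]; ring
        _ = _ := by
          rw [k2]
          field_simp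
  · intro π hπ
    by_contra! hd
    exact not_dvd_symmetric hπ.prime hA.1 hC.1 ⟨hd 0, hd 1, hd 2⟩
  · intro π hπ
    by_contra! hd
    exact not_dvd_addSub hl0 hl1 h2 hπ.prime h.1 ⟨hd 0, hd 1, hd 2⟩

/-! ### The Frobenius point and the character sum -/

variable [Fintype F]

/-- The Frobenius point `(X ^ q, c ^ ((q - 1) / 2))` of `c y² = x (x - 1) (x - l)`. -/
noncomputable def frobeniusPoint (l : F) (h2 : (2 : F) ≠ 0) : (twist l).Point :=
  .some _ _ (nonsingular_twist (l := l) (x := X ^ Fintype.card F)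
    (y := cubic l ^ (Fintype.card F / 2)) h2 (pow_ne_zero _ (cubic_ne_zero l)) (by
      have hq : 2 * (Fintype.card F / 2) + 1 = Fintype.card F :=
        Nat.two_mul_div_two_add_one_of_odd (Nat.odd_iff.2
          (FiniteField.odd_card_of_char_ne_two (by
            intro h
            have := ringChar.Nat.cast_ringChar (R := F)
            rw [h] at this
            exact h2 (by exact_mod_cast this))))
      rw [← pow_mul, mul_comm (Fintype.card F / 2), ← pow_succ', hq, ← FiniteField.expand_card]
      simp [cubic]))

theorem X_pow_card_sub_X_ne_zero : (X ^ Fintype.card F - X : F[X]) ≠ 0 :=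
  FiniteField.X_pow_card_sub_X_ne_zero F Fintype.one_lt_card

/-- The explicit, unreduced, fraction for `Frobenius - Q`. -/
theorem IsReducedX.frobenius_sub_generic [DecidableEq (RatFunc F)] {l : F} (h2 : (2 : F) ≠ 0)
    {A B : F[X]} (h : IsReducedX (frobeniusPoint l h2 - genericPoint l h2) A B) :
    A * (X ^ Fintype.card F - X) ^ 2 =
      (cubic l * (cubic l ^ (Fintype.card F / 2) + 1) ^ 2 +
        (1 + C l - X ^ Fintype.card F - X) * (X ^ Fintype.card F - X) ^ 2) * B := by
  have hc := algebraMap_ratFunc_ne_zero_iff.2 (cubic_ne_zero l)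
  have hN := algebraMap_ratFunc_ne_zero_iff.2 (X_pow_card_sub_X_ne_zero (F := F))
  have h' := h.2
  have hx : algebraMap F[X] (RatFunc F) (cubic l * X ^ Fintype.card F) ≠
      algebraMap F[X] (RatFunc F) (cubic l * X) := by
    intro e
    rw [(RatFunc.algebraMap_injective F).eq_iff] at e
    exact X_pow_card_sub_X_ne_zero (sub_eq_zero.2 (mul_left_cancel₀ (cubic_ne_zero l) e))
  have hx' := sub_ne_zero.2 hx
  rw [frobeniusPoint, genericPoint, sub_eq_add_neg, WeierstrassCurve.Affine.Point.neg_some,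
    WeierstrassCurve.Affine.Point.add_of_X_ne hx, WeierstrassCurve.Affine.Point.xRep_some] at h'
  simp only [Matrix.cons_val_zero, Matrix.cons_val_one, Matrix.cons_val_fin_one,
    WeierstrassCurve.Affine.addX, WeierstrassCurve.Affine.slope_of_X_ne hx,
    WeierstrassCurve.Affine.negY] at h'
  apply RatFunc.algebraMap_injective F
  apply mul_left_cancel₀ (pow_ne_zero 3 hc)
  simp only [twist, map_mul, map_add, map_sub, map_pow, map_one] at *
  rw [← mul_sub] at h'
  field_simp at h'
  linear_combination h'

/-- The reduced denominator of `Frobenius - Q` vanishes at `a` to order `0`, `1` or `2` according to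
the quadratic character of `a (a - 1) (a - l)`. -/
theorem rootMultiplicity_of_reduced [DecidableEq F] {l : F} (hl0 : l ≠ 0) (hl1 : l ≠ 1)
    (h2 : (2 : F) ≠ 0) {A B : F[X]} (hAB : IsCoprime A B) (hA : A ≠ 0)
    (h : A * (X ^ Fintype.card F - X) ^ 2 =
      (cubic l * (cubic l ^ (Fintype.card F / 2) + 1) ^ 2 +
        (1 + C l - X ^ Fintype.card F - X) * (X ^ Fintype.card F - X) ^ 2) * B) (a : F) :
    (rootMultiplicity a B : ℤ) = 1 + quadraticChar F (a * (a - 1) * (a - l)) := by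
  have hchar : ringChar F ≠ 2 := by
    intro h
    have := ringChar.Nat.cast_ringChar (R := F)
    rw [h] at this
    exact h2 (by exact_mod_cast this)
  have hm : Fintype.card F / 2 ≠ 0 := (Nat.div_pos Fintype.one_lt_card two_pos).ne'
  set m := Fintype.card F / 2 with hmdef
  set N : F[X] := X ^ Fintype.card F - X with hNdef
  have hN0 : N ≠ 0 := X_pow_card_sub_X_ne_zero
  set R := cubic l * (cubic l ^ m + 1) ^ 2 + (1 + C l - X ^ Fintype.card F - X) * N ^ 2 with hR
  have hAN : A * N ^ 2 ≠ 0 := mul_ne_zero hA (pow_ne_zero 2 hN0)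
  have hRB : R * B ≠ 0 := h ▸ hAN
  have hR0 : R ≠ 0 := left_ne_zero_of_mul hRB
  have hNa : eval a N = 0 := by simp [hNdef, FiniteField.pow_card]
  have hrN : rootMultiplicity a N = 1 := by
    rw [← count_roots, hNdef, FiniteField.roots_X_pow_card_sub_X]
    exact Multiset.count_eq_one_of_mem Finset.univ.nodup (Finset.mem_univ a)
  have hrm : rootMultiplicity a A + 2 = rootMultiplicity a R + rootMultiplicity a B := by
    rw [← rootMultiplicity_mul hRB, ← h, rootMultiplicity_mul hAN, sq,
      rootMultiplicity_mul (mul_ne_zero hN0 hN0), hrN]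
  have hor : rootMultiplicity a A = 0 ∨ rootMultiplicity a B = 0 := by
    by_contra! hne
    have ha := dvd_iff_isRoot.2 ((rootMultiplicity_pos hA).1 (Nat.pos_of_ne_zero hne.1))
    have hb := dvd_iff_isRoot.2 ((rootMultiplicity_pos (right_ne_zero_of_mul hRB)).1
      (Nat.pos_of_ne_zero hne.2))
    exact (irreducible_X_sub_C a).not_isUnit (hAB.isUnit_of_dvd' ha hb)
  have hca : eval a (cubic l) = a * (a - 1) * (a - l) := by simp [cubic]
  have hpow := quadraticChar_eq_pow_of_char_ne_two' hchar (a * (a - 1) * (a - l))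
  rw [← hmdef] at hpow
  rcases eq_or_ne (a * (a - 1) * (a - l)) 0 with h0 | h0
  · -- `c` has a simple zero at `a`, hence so does the unreduced numerator
    have r1 : R.IsRoot a := by
      simp [hR, hNa, hca, h0]
    have r2 : ¬ (derivative R).IsRoot a := by
      have hd : eval a (derivative (cubic l)) ≠ 0 := by
        simp only [cubic, derivative_mul, derivative_X, derivative_sub, derivative_one,
          derivative_C, eval_add, eval_mul, eval_sub, eval_X, eval_one, eval_C, eval_zero]
        intro hd
        rcases mul_eq_zero.1 h0 with h0 | h0
        · rcases mul_eq_zero.1 h0 with h0 | h0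
          · subst h0
            exact hl0 (by linear_combination hd)
          · rw [sub_eq_zero] at h0
            subst h0
            exact hl1 (by linear_combination -hd)
        · rw [sub_eq_zero] at h0
          subst h0
          have : a * (a - 1) = 0 := by linear_combination hd
          rcases mul_eq_zero.1 this with h | h
          · exact hl0 h
          · exact hl1 (sub_eq_zero.1 h)
      rw [IsRoot.def]
      simp only [hR, derivative_add, derivative_mul, derivative_sq, eval_add, eval_mul, eval_pow,
        hNa, hca, h0]
      simpa [hm] using hd
    have hr1 : rootMultiplicity a R = 1 := by
      have q1 := (rootMultiplicity_pos hR0).2 r1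
      have q2 : ¬ 1 < rootMultiplicity a R := fun hlt ↦
        r2 ((one_lt_rootMultiplicity_iff_isRoot hR0).1 hlt).2
      omega
    rw [h0, MulChar.map_zero]
    omega
  · rcases quadraticChar_dichotomy h0 with hχ | hχ
    · have hr0 : rootMultiplicity a R = 0 := by
        rw [rootMultiplicity_eq_zero_iff]
        intro hroot
        exfalso
        rw [hχ, Int.cast_one] at hpow
        rw [IsRoot.def, hR] at hroot
        simp only [eval_add, eval_mul, eval_pow, hNa, hca, eval_one, ← hpow] at hroot
        have : a * (a - 1) * (a - l) * (2 * 2) = 0 := by linear_combination hroot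
        exact mul_ne_zero h0 (mul_ne_zero h2 h2) this
      rw [hχ]
      omega
    · have hr2 : 2 ≤ rootMultiplicity a R := by
        rw [le_rootMultiplicity_iff hR0]
        refine dvd_add (Dvd.dvd.mul_left (pow_dvd_pow_of_dvd (dvd_iff_isRoot.2 ?_) 2) _)
          (Dvd.dvd.mul_left (pow_dvd_pow_of_dvd (dvd_iff_isRoot.2 hNa) 2) _)
        rw [hχ, Int.cast_neg, Int.cast_one] at hpow
        simp [hca, ← hpow]
      rw [hχ]
      omega

/-- The reduced denominator divides `(X ^ q - X) ^ 2`, so its degree is the sum of its root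
multiplicities over `F`. -/
theorem natDegree_of_reduced [DecidableEq F] {l : F} (hl0 : l ≠ 0) (hl1 : l ≠ 1)
    (h2 : (2 : F) ≠ 0) {A B : F[X]} (hAB : IsCoprime A B) (hA : A ≠ 0)
    (h : A * (X ^ Fintype.card F - X) ^ 2 =
      (cubic l * (cubic l ^ (Fintype.card F / 2) + 1) ^ 2 +
        (1 + C l - X ^ Fintype.card F - X) * (X ^ Fintype.card F - X) ^ 2) * B) :
    (B.natDegree : ℤ) =
      Fintype.card F + ∑ a : F, quadraticChar F (a * (a - 1) * (a - l)) := by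
  have hd : B ∣ (X ^ Fintype.card F - X) ^ 2 :=
    hAB.symm.dvd_of_dvd_mul_left (Dvd.intro_left _ h.symm)
  have hs : B.Splits := (Splits.pow (by
    rw [splits_iff_card_roots, FiniteField.roots_X_pow_card_sub_X,
      FiniteField.X_pow_card_sub_X_natDegree_eq F Fintype.one_lt_card]
    rfl) 2).of_dvd (pow_ne_zero 2 X_pow_card_sub_X_ne_zero) hd
  rw [hs.natDegree_eq_card_roots,
    ← Multiset.sum_count_eq_card (s := Finset.univ) (fun a _ ↦ Finset.mem_univ a), Nat.cast_sum]
  simp only [count_roots, rootMultiplicity_of_reduced hl0 hl1 h2 hAB hA h, Finset.sum_add_distrib]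
  simp

/-! ### Hasse's bound -/

/-- The only solution of the parallelogram recursion with the given initial values. -/
theorem eq_quadratic_of_recursion {d : ℤ → ℤ} {q s : ℤ} (h0 : d 0 = q) (h1 : d (-1) = q + 1 + s)
    (h : ∀ n, d (n + 1) + d (n - 1) = 2 * d n + 2) (n : ℤ) : d n = n ^ 2 - s * n + q := by
  suffices H : d n = n ^ 2 - s * n + q ∧ d (n - 1) = (n - 1) ^ 2 - s * (n - 1) + q from H.1
  induction n using Int.induction_on with
  | zero => exact ⟨by rw [h0]; ring, by rw [zero_sub, h1]; ring⟩
  | succ n ih =>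
    have := h n
    rw [add_sub_cancel_right]
    exact ⟨by linear_combination this + 2 * ih.1 - ih.2, ih.1⟩
  | pred n ih =>
    have := h (-n - 1)
    rw [sub_add_cancel] at this
    exact ⟨ih.2, by linear_combination this + 2 * ih.2 - ih.1⟩

/-- A monic integral quadratic with odd constant term that is nonnegative at all integers has
nonpositive discriminant. -/
theorem sq_le_of_forall_nonneg {q s : ℤ} (hq : Odd q) (h : ∀ n : ℤ, 0 ≤ n ^ 2 - s * n + q) :
    s ^ 2 ≤ 4 * q := by
  rcases Int.even_or_odd' s with ⟨k, rfl | rfl⟩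
  · linarith [h k]
  · have h1 := h k
    have hne : q ≠ k * (k + 1) := by
      rintro rfl
      exact Int.not_odd_iff_even.2 (Int.even_mul_succ_self k) hq
    have : k * (k + 1) < q := lt_of_le_of_ne (by linarith) hne.symm
    linarith

/-- Hasse's bound for the Legendre curve `y² = x (x - 1) (x - l)`. -/
theorem sq_sum_quadraticChar_le [DecidableEq F] {l : F} (hl0 : l ≠ 0) (hl1 : l ≠ 1)
    (hF : ringChar F ≠ 2) :
    (∑ a : F, quadraticChar F (a * (a - 1) * (a - l))) ^ 2 ≤ 4 * (Fintype.card F : ℤ) := by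
  classical
  have h2 : (2 : F) ≠ 0 := Ring.two_ne_zero hF
  set Q := genericPoint l h2
  set P : ℤ → (twist l).Point := fun n ↦ frobeniusPoint l h2 + n • Q with hP
  have hadd : ∀ n, P (n + 1) = P n + Q := fun n ↦ by
    simp only [hP, add_zsmul, one_zsmul, add_assoc]
  have hsub : ∀ n, P (n - 1) = P n - Q := fun n ↦ by
    rw [eq_sub_iff_add_eq, ← hadd, sub_add_cancel]
  choose f g hfg using fun n ↦ exists_isReducedX (P n)
  have assoc := fun n ↦ (hfg n).associated hl0 hl1 h2 (hadd n ▸ hfg (n + 1)) (hsub n ▸ hfg (n - 1))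
  have step := fun n (hlt : (g n).degree < (f n).degree) ↦
    degree_of_associated hlt (assoc n).1 (assoc n).2.1 (assoc n).2.2
  have base : f 0 = g 0 * X ^ Fintype.card F := by
    have h := (hfg 0).2
    have e : P 0 = frobeniusPoint l h2 := by simp [hP]
    rw [e] at h
    simp only [frobeniusPoint, WeierstrassCurve.Affine.Point.xRep_some, Matrix.cons_val_zero,
      Matrix.cons_val_one, Matrix.cons_val_fin_one, mul_one, ← map_mul] at h
    have h := RatFunc.algebraMap_injective F h
    exact mul_right_cancel₀ (cubic_ne_zero l) (by linear_combination h)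
  have hu : IsUnit (g 0) := (hfg 0).1.isUnit_of_dvd' (Dvd.intro _ base.symm) dvd_rfl
  have hdeg0 : (f 0).natDegree = Fintype.card F := by
    rw [base, natDegree_mul hu.ne_zero (pow_ne_zero _ X_ne_zero), natDegree_eq_zero_of_isUnit hu,
      natDegree_X_pow, zero_add]
  have hlt0 : (g 0).degree < (f 0).degree := by
    rw [base, degree_mul, degree_eq_zero_of_isUnit hu, degree_X_pow, zero_add]
    exact_mod_cast Fintype.card_pos
  -- all the points considered reduce to the neutral element at the place `X = ∞`
  have hlt : ∀ n, (g n).degree < (f n).degree := by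
    intro n
    induction n using Int.induction_on with
    | zero => exact hlt0
    | succ n ih => exact (step n ih).1.1
    | pred n ih => exact (step _ ih).1.2
  have hne : ∀ n, f n ≠ 0 := fun n h ↦ by simpa [h] using hlt n
  have hred := natDegree_of_reduced hl0 hl1 h2 (hfg (-1)).1 (hne (-1)) (by
    have h := hfg (-1)
    have e : P (-1) = frobeniusPoint l h2 - Q := by simp [hP, sub_eq_add_neg]
    rw [e] at h
    exact h.frobenius_sub_generic h2)
  -- for `n = 0`, the products of the two neighbouring numerators and denominators have degrees
  -- `2 q + 2` and `2 q`
  have hg : (g 1).natDegree + (g (-1)).natDegree = 2 * Fintype.card F := by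
    have h := (assoc 0).2.2
    rw [base, show g 0 * X ^ Fintype.card F - X * g 0 = g 0 * (X ^ Fintype.card F - X) by ring] at h
    have hN := X_pow_card_sub_X_ne_zero (F := F)
    have hne' := h.ne_zero_iff.2 (pow_ne_zero 2 (mul_ne_zero hu.ne_zero hN))
    have hd := natDegree_eq_of_degree_eq (degree_eq_degree_of_associated h)
    rw [natDegree_mul (left_ne_zero_of_mul hne') (right_ne_zero_of_mul hne'), natDegree_pow,
      natDegree_mul hu.ne_zero hN, natDegree_eq_zero_of_isUnit hu,
      FiniteField.X_pow_card_sub_X_natDegree_eq F Fintype.one_lt_card, zero_add, zero_add,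
      zero_sub] at hd
    exact hd
  have hf := (step 0 hlt0).2
  have hnat : ∀ n, g n ≠ 0 → (g n).natDegree < (f n).natDegree := fun n h ↦
    natDegree_lt_natDegree h (hlt n)
  have hg0 : g 1 ≠ 0 ∧ g (-1) ≠ 0 := by
    have h := (assoc 0).2.2
    rw [base, show g 0 * X ^ Fintype.card F - X * g 0 = g 0 * (X ^ Fintype.card F - X) by ring] at h
    exact mul_ne_zero_iff.1 (h.ne_zero_iff.2 (pow_ne_zero 2
      (mul_ne_zero hu.ne_zero X_pow_card_sub_X_ne_zero)))
  have hn1 := hnat 1 hg0.1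
  have hn2 := hnat (-1) hg0.2
  rw [zero_add, zero_sub, hdeg0] at hf
  have hodd : Odd (Fintype.card F : ℤ) := by
    exact_mod_cast Nat.odd_iff.2 (FiniteField.odd_card_of_char_ne_two hF)
  refine sq_le_of_forall_nonneg hodd fun n ↦ ?_
  rw [← eq_quadratic_of_recursion (d := fun n ↦ ((f n).natDegree : ℤ)) ?_ ?_ ?_ n]
  · positivity
  · exact_mod_cast hdeg0
  · -- numerators exceed denominators in degree, by exactly `2` in total, hence by `1` each
    show ((f (-1)).natDegree : ℤ) = _
    omega
  · intro n
    exact_mod_cast (step n (hlt n)).2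

end LegendreTwist

/-! ### Points on the Edwards curve -/

section Edwards

variable {F : Type*} [Field F] [Fintype F] [DecidableEq F]

theorem card_filter_sq_eq (hF : ringChar F ≠ 2) (a : F) :
    ((Finset.univ.filter fun x : F ↦ x ^ 2 = a).card : ℤ) = 1 + quadraticChar F a := by
  rw [add_comm, ← quadraticChar_card_sqrts hF a]
  congr 2
  ext x
  simp

theorem quadraticChar_mul_sq {a b : F} (hb : b ≠ 0) :
    quadraticChar F (a * b ^ 2) = quadraticChar F a := by
  rw [map_mul, quadraticChar_sq_one' hb, mul_one]

/-- Summation over squares: each `u` has `1 + χ(u)` square roots. -/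
theorem sum_comp_sq (hF : ringChar F ≠ 2) (g : F → ℤ) :
    ∑ y : F, g (y ^ 2) = ∑ u : F, (1 + quadraticChar F u) * g u := by
  rw [← Finset.sum_fiberwise Finset.univ (fun y : F ↦ y ^ 2)]
  refine Finset.sum_congr rfl fun u _ ↦ ?_
  rw [← card_filter_sq_eq hF, ← nsmul_eq_mul, ← Finset.sum_const]
  refine Finset.sum_congr rfl fun y hy ↦ ?_
  rw [(Finset.mem_filter.1 hy).2]

/-- The substitution `x = d + (1 - d) / (1 - u)` turns this sum into the full character sum, with
the term `x = d` (reached at `u = 1`, as `0⁻¹ = 0`) missing. -/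
theorem sum_quadraticChar_one_sub (hF : ringChar F ≠ 2) {d : F} (hd1 : d ≠ 1) :
    ∑ u : F, quadraticChar F ((1 - u) * (1 - d * u)) = -quadraticChar F d := by
  have hinj : Function.Injective fun u : F ↦ d + (1 - d) * (1 - u)⁻¹ := by
    intro u v h
    have h1 := mul_left_cancel₀ (sub_ne_zero.2 hd1.symm) (add_left_cancel h)
    exact sub_right_injective (inv_injective h1)
  have h0 := (Finite.injective_iff_bijective.1 hinj).sum_comp (fun x ↦ quadraticChar F x)
  rw [quadraticChar_sum_zero hF] at h0
  have key : ∀ u : F, quadraticChar F ((1 - u) * (1 - d * u)) =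
      quadraticChar F (d + (1 - d) * (1 - u)⁻¹) - if u = 1 then quadraticChar F d else 0 := by
    intro u
    split_ifs with h
    · simp [h]
    · have hu : 1 - u ≠ 0 := sub_ne_zero.2 (Ne.symm h)
      rw [sub_zero, ← quadraticChar_mul_sq (a := d + (1 - d) * (1 - u)⁻¹) hu]
      congr 1
      field_simp
      ring
  rw [Finset.sum_congr rfl fun u _ ↦ key u, Finset.sum_sub_distrib, h0]
  simp

/-- The substitution `v = d u`. -/
theorem sum_quadraticChar_legendre {d : F} (hd0 : d ≠ 0) :
    ∑ v : F, quadraticChar F (v * (v - 1) * (v - d)) =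
      ∑ u : F, quadraticChar F (u * (1 - u) * (1 - d * u)) := by
  rw [← (mulLeft_bijective₀ d hd0).sum_comp]
  refine Finset.sum_congr rfl fun u _ ↦ ?_
  rw [← quadraticChar_mul_sq (a := u * (1 - u) * (1 - d * u)) hd0]
  congr 1
  ring

theorem sum_quadraticChar_jacobi_quartic (hF : ringChar F ≠ 2) {d : F} (hd1 : d ≠ 1) :
    ∑ y : F, quadraticChar F ((1 - y ^ 2) * (1 - d * y ^ 2)) =
      -quadraticChar F d + ∑ u : F, quadraticChar F (u * (1 - u) * (1 - d * u)) := by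
  rw [sum_comp_sq hF (fun u ↦ quadraticChar F ((1 - u) * (1 - d * u))),
    ← sum_quadraticChar_one_sub hF hd1, ← Finset.sum_add_distrib]
  refine Finset.sum_congr rfl fun u _ ↦ ?_
  rw [mul_assoc, map_mul (quadraticChar F) u]
  ring

/-- The number of points of the Edwards curve on a horizontal line. The correction term accounts for
the lines `d y² = 1`, which meet the curve only at infinity. -/
theorem card_filter_edwards (hF : ringChar F ≠ 2) {d : F} (hd0 : d ≠ 0) (hd1 : d ≠ 1)
    (y : F) :
    ((Finset.univ.filter fun x : F ↦ x ^ 2 + y ^ 2 = 1 + d * x ^ 2 * y ^ 2).card : ℤ) =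
      1 + quadraticChar F ((1 - y ^ 2) * (1 - d * y ^ 2)) - if y ^ 2 = d⁻¹ then 1 else 0 := by
  by_cases h : 1 - d * y ^ 2 = 0
  · have hy : y ^ 2 = d⁻¹ := eq_inv_of_mul_eq_one_right (by linear_combination -h)
    rw [h, mul_zero, MulChar.map_zero, if_pos hy, add_zero, sub_self, Nat.cast_eq_zero,
      Finset.card_eq_zero, Finset.filter_eq_empty_iff]
    intro x _ hx
    have hy1 : y ^ 2 = 1 := by linear_combination hx - x ^ 2 * h
    rw [hy1] at h
    exact hd1 (by linear_combination -h)
  · have hy : y ^ 2 ≠ d⁻¹ := by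
      intro hy
      exact h (by rw [hy, mul_inv_cancel₀ hd0, sub_self])
    rw [if_neg hy, sub_zero]
    have e : (1 - y ^ 2) * (1 - d * y ^ 2) =
        (1 - y ^ 2) / (1 - d * y ^ 2) * (1 - d * y ^ 2) ^ 2 := by
      field_simp
    rw [e, quadraticChar_mul_sq h, ← card_filter_sq_eq hF]
    congr 2
    ext x
    simp only [Finset.mem_filter, Finset.mem_univ, true_and]
    rw [eq_div_iff h]
    constructor <;> intro hx <;> linear_combination hx

theorem ncard_edwardsCurve (hF : ringChar F ≠ 2) {d : F} (hd0 : d ≠ 0) (hd1 : d ≠ 1) :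
    ((edwardsCurve d).ncard : ℤ) = Fintype.card F - 1 - 2 * quadraticChar F d +
      ∑ u : F, quadraticChar F (u * (1 - u) * (1 - d * u)) := by
  have hinv : quadraticChar F d⁻¹ = quadraticChar F d := by
    rw [← quadraticChar_mul_sq (a := d⁻¹) hd0, sq, ← mul_assoc, inv_mul_cancel₀ hd0, one_mul]
  have hcard : (edwardsCurve d).ncard = ∑ y : F,
      (Finset.univ.filter fun x : F ↦ x ^ 2 + y ^ 2 = 1 + d * x ^ 2 * y ^ 2).card := by
    have e : edwardsCurve d = (Finset.univ.filter fun P : F × F ↦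
        P.1 ^ 2 + P.2 ^ 2 = 1 + d * P.1 ^ 2 * P.2 ^ 2 : Finset (F × F)) := by
      ext P
      simp [edwardsCurve]
    rw [e, Set.ncard_coe_finset]
    simp only [Finset.card_filter]
    rw [Fintype.sum_prod_type_right]
  have hdel : ∑ y : F, (if y ^ 2 = d⁻¹ then (1 : ℤ) else 0) = 1 + quadraticChar F d := by
    rw [← hinv, ← card_filter_sq_eq hF, Finset.sum_boole]
  rw [hcard, Nat.cast_sum, Finset.sum_congr rfl fun y _ ↦ card_filter_edwards hF hd0 hd1 y,
    Finset.sum_sub_distrib, Finset.sum_add_distrib, hdel, sum_quadraticChar_jacobi_quartic hF hd1]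
  simp
  ring

end Edwards

/-! ### The character sum modulo the characteristic -/

theorem sum_pow_of_lt_two_mul {F : Type*} [Field F] [Fintype F] {k : ℕ} (hk0 : 0 < k)
    (hk : k < 2 * (Fintype.card F - 1)) :
    ∑ u : F, u ^ k = if k = Fintype.card F - 1 then -1 else 0 := by
  classical
  have h1 := Fintype.one_lt_card (α := F)
  split_ifs with h
  · have e : ∀ u : F, u ^ k = 1 - if u = 0 then 1 else 0 := by
      intro u
      split_ifs with hu
      · simp [hu, hk0.ne']
      · rw [h, FiniteField.pow_card_sub_one_eq_one u hu, sub_zero]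
    simp [e]
  · rcases lt_or_gt_of_ne h with h | h
    · exact FiniteField.sum_pow_lt_card_sub_one F k h
    · have e : ∀ u : F, u ^ k = u ^ (k - (Fintype.card F - 1)) := by
        intro u
        have e1 : k = Fintype.card F + (k - (Fintype.card F - 1) - 1) := by omega
        have e2 : k - (Fintype.card F - 1) = 1 + (k - (Fintype.card F - 1) - 1) := by omega
        rw [e2]
        nth_rewrite 1 [e1]
        rw [pow_add, FiniteField.pow_card, pow_add, pow_one]
      rw [Finset.sum_congr rfl fun u _ ↦ e u]
      exact FiniteField.sum_pow_lt_card_sub_one F _ (by omega)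

/-- Expand by the binomial theorem. The exponents of `u` lie in `[m, 3m]`, so only the monomials
`u ^ (2m)` survive the summation over `u`. -/
theorem sum_legendre_pow {F : Type*} [Field F] [Fintype F] {m : ℕ}
    (hm : Fintype.card F = 2 * m + 1) (d : F) :
    ∑ u : F, (u * (1 - u) * (1 - d * u)) ^ m =
      -(-1) ^ m * ∑ j ∈ Finset.range (m + 1), (m.choose j : F) ^ 2 * d ^ j := by
  have hm0 : 0 < m := by
    have := Fintype.one_lt_card (α := F)
    omega
  have expand : ∀ u : F, (u * (1 - u) * (1 - d * u)) ^ m =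
      ∑ j ∈ Finset.range (m + 1), ∑ i ∈ Finset.range (m + 1),
        (m.choose i * m.choose j * (-1) ^ (i + j) * d ^ j : F) * u ^ (m + i + j) := by
    intro u
    have h1 : (1 - u) ^ m = ∑ i ∈ Finset.range (m + 1), (-u) ^ i * m.choose i := by
      rw [sub_eq_neg_add, add_pow]
      simp
    have h2 : (1 - d * u) ^ m = ∑ i ∈ Finset.range (m + 1), (-(d * u)) ^ i * m.choose i := by
      rw [sub_eq_neg_add, add_pow]
      simp
    rw [mul_pow, mul_pow, h1, h2, Finset.mul_sum, Finset.mul_sum]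
    refine Finset.sum_congr rfl fun j _ ↦ ?_
    rw [Finset.sum_mul]
    refine Finset.sum_congr rfl fun i _ ↦ ?_
    rw [neg_pow u, neg_pow (d * u), mul_pow]
    ring
  rw [Finset.sum_congr rfl fun u _ ↦ expand u, Finset.sum_comm, Finset.mul_sum]
  refine Finset.sum_congr rfl fun j hj ↦ ?_
  have hj : j ≤ m := Finset.mem_range_succ_iff.1 hj
  rw [Finset.sum_comm,
    Finset.sum_eq_single_of_mem (m - j) (Finset.mem_range_succ_iff.2 (by omega))]
  · rw [← Finset.mul_sum, sum_pow_of_lt_two_mul (by omega) (by omega), if_pos (by omega),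
      Nat.choose_symm hj, Nat.sub_add_cancel hj]
    ring
  · intro i hi hne
    have hi : i ≤ m := Finset.mem_range_succ_iff.1 hi
    rw [← Finset.mul_sum, sum_pow_of_lt_two_mul (by omega) (by omega), if_neg (by omega),
      mul_zero]

theorem mainTheorem10 (p : ℕ) [Fact p.Prime] (hp : p % 4 = 3)
    (d : ZMod p) (hd0 : d ≠ 0) (hd1 : d ≠ 1) :
    ∃ T : ℤ,
      (T : ZMod p) =
        ∑ j ∈ Finset.range ((p - 1) / 2 + 1),
          (Nat.choose ((p - 1) / 2) j : ZMod p) ^ 2 * d ^ j ∧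
      |(T : ℝ)| ≤ 2 * Real.sqrt (p : ℝ) ∧
      (edwardsOrder p d : ℤ) = (p : ℤ) - 1 - 2 * legendreSym p (d.val : ℤ) + T := by
  have hF : ringChar (ZMod p) ≠ 2 := by
    rw [ZMod.ringChar_zmod_n]
    omega
  refine ⟨∑ u : ZMod p, quadraticChar (ZMod p) (u * (1 - u) * (1 - d * u)), ?_, ?_, ?_⟩
  · have hm : Fintype.card (ZMod p) = 2 * ((p - 1) / 2) + 1 := by
      rw [ZMod.card]
      omega
    have hodd : Odd ((p - 1) / 2) := Nat.odd_iff.2 (by omega)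
    have h2 : Fintype.card (ZMod p) / 2 = (p - 1) / 2 := by omega
    rw [Int.cast_sum, Finset.sum_congr rfl fun u _ ↦ quadraticChar_eq_pow_of_char_ne_two' hF _, h2,
      sum_legendre_pow hm d, hodd.neg_one_pow, neg_neg, one_mul]
  · have h := LegendreTwist.sq_sum_quadraticChar_le hd0 hd1 hF
    rw [sum_quadraticChar_legendre hd0, ZMod.card] at h
    have h' : ((∑ u : ZMod p, quadraticChar (ZMod p) (u * (1 - u) * (1 - d * u)) : ℤ) : ℝ) ^ 2 ≤
        2 ^ 2 * (p : ℝ) := by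
      norm_num
      exact_mod_cast h
    refine (Real.abs_le_sqrt h').trans_eq ?_
    rw [Real.sqrt_mul (by positivity), Real.sqrt_sq (by norm_num)]
  · have e : legendreSym p (d.val : ℤ) = quadraticChar (ZMod p) d := by
      rw [legendreSym, Int.cast_natCast, ZMod.natCast_zmod_val]
    rw [e, edwardsOrder, ncard_edwardsCurve hF hd0 hd1, ZMod.card]
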